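/- Let $1\le k$ and $m$ be integers with $k\le\sqrt{m(\log 2)/e}$. Let the $n=\binom m2$ coordinates of a random vector $\mathbf X=(X_e)$ be indexed by the edges of the complete graph $K_m$, and let $\mathcal C$ be the class of the edge sets of all cliques on $k$ vertices of $K_m$ (so each $S\in\mathcal C$ has $\binom k2$ edges, and $N=|\mathcal C|=\binom mk$ when $k\ge2$). For $\mu>0$, let $\mathbb P_0$ be the law of $\mathbf X$ under which the $X_e$ are independent standard normal, and for $S\in\mathcal C$ let $\mathbb P_S$ be the law under which the $X_e$ are independent, with $X_e\sim\mathcal N(\mu,1)$ for $e\in S$ and $X_e\sim\mathcal N(0,1)$ for $e\notin S$; let $\phi_0,\phi_S$ be their Lebesgue densities. The risk of a test $f:\mathbb R^n\to\{0,1\}$ is \[ R(f)=\mathbb P_0\{f(\mathbf X)=1\}+\frac1N\sum_{S\in\mathcal C}\mathbb P_S\{f(\mathbf X)=0\}, \] and $R^*=R^*(\mu)=R(f^*)$ is the risk of the optimal (likelihood ratio) test $f^*(\mathbf x)=\mathbf 1\{L(\mathbf x)>1\}$, where $L(\mathbf x)=\frac1N\sum_{S\in\mathcal C}\phi_S(\mathbf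 x)/\phi_0(\mathbf x)$. Then: (i) if $k\ge2$, then for all $\delta\in(0,1)$, $R^*\le\delta$ for every $\mu>0$ with \[ \mu\ge 2\sqrt{\frac1{k-1}\log\Bigl(\frac{me}{k}\Bigr)}+4\sqrt{\frac{\log(2/\delta)}{k(k-1)}}; \] (ii) $R^*\ge\frac12$ for every $\mu>0$ with \[ \mu\le\sqrt{\frac1k\log\Bigl(\frac m{2k}\Bigr)}. \] -/

import Mathlib

open MeasureTheory ProbabilityTheory

noncomputable section

namespace CliqueTesting

variable {ι : Type*} [Fintype ι]

/-- The mean of coordinate `i` when the contaminated set is `S`: it is `μ` on `S` and `0` off `S`. -/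
def meanAt (S : Finset ι) (μ : ℝ) (i : ι) : ℝ := by
  classical exact if i ∈ S then μ else 0

/-- The null law: independent standard normal coordinates. -/
def nullLaw (ι : Type*) [Fintype ι] : Measure (ι → ℝ) :=
  Measure.pi fun _ : ι => gaussianReal 0 1

/-- The law with contaminated set `S`: independent coordinates, normal with variance `1`,
with mean `μ` on `S` and mean `0` off `S`. -/
def contaminatedLaw (S : Finset ι) (μ : ℝ) : Measure (ι → ℝ) :=
  Measure.pi fun i => gaussianReal (meanAt S μ i) 1

/-- The Lebesgue density of the null law. -/
def nullDensity (x : ι → ℝ) : ℝ := ∏ i, gaussianPDFReal 0 1 (x i)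

/-- The Lebesgue density of the law with contaminated set `S`. -/
def contaminatedDensity (S : Finset ι) (μ : ℝ) (x : ι → ℝ) : ℝ :=
  ∏ i, gaussianPDFReal (meanAt S μ i) 1 (x i)

/-- The risk of a test `f` (`true` means that the null hypothesis is rejected) for the class `C`:
type I error plus the average over `S ∈ C` of the type II errors. -/
def risk (C : Finset (Finset ι)) (μ : ℝ) (f : (ι → ℝ) → Bool) : ℝ :=
  (nullLaw ι).real {x | f x = true} +
    1 / (C.card : ℝ) * ∑ S ∈ C, (contaminatedLaw S μ).real {x | f x = false}

/-- The likelihood ratio of the uniform mixture over `C` against the null law. -/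
def likelihoodRatio (C : Finset (Finset ι)) (μ : ℝ) (x : ι → ℝ) : ℝ :=
  (1 / (C.card : ℝ) * ∑ S ∈ C, contaminatedDensity S μ x) / nullDensity x

/-- The optimal (likelihood ratio) test: reject exactly when the likelihood ratio exceeds `1`. -/
def optimalTest (C : Finset (Finset ι)) (μ : ℝ) (x : ι → ℝ) : Bool := by
  classical exact decide (1 < likelihoodRatio C μ x)

/-- The Bayes risk `R*`: the risk of the optimal test. -/
def bayesRisk (C : Finset (Finset ι)) (μ : ℝ) : ℝ := risk C μ (optimalTest C μ)

/-- The edges of the complete graph on `m` vertices. -/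
abbrev Edge (m : ℕ) : Type := (⊤ : SimpleGraph (Fin m)).edgeSet

/-- The set of edges of the complete graph with both endpoints in the vertex set `V`. -/
def edgesWithin {m : ℕ} (V : Finset (Fin m)) : Finset (Edge m) :=
  Finset.univ.filter fun e => ∀ v ∈ (e : Sym2 (Fin m)), v ∈ V

/-- The class of (the edge sets of) all cliques on `k` vertices in the complete graph on `m`
vertices. -/
def cliqueClass (m k : ℕ) : Finset (Finset (Edge m)) :=
  ((⊤ : SimpleGraph (Fin m)).cliqueFinset k).image edgesWithin

end CliqueTesting

end

open MeasureTheory ProbabilityTheory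

namespace CliqueTesting

/-! ### Gaussian likelihood ratios, the risk identity and the second moment method. -/

section Probability

variable {ι : Type*} [Fintype ι]

/-! Upper bound: the likelihood ratio test minimises the risk (`bayesRisk_le_risk`), so it suffices
to bound the scan test, which rejects when some clique has a large edge sum. A union bound, Gaussian
tails and `N ≤ (me/k)^k` control both errors (`bayesRisk_le_of_scan`).

Lower bound: the risk equals `1 - E₀(L - 1)⁺`, and `L - 1 ≤ L² / 4`, so `E₀ L² ≤ 2` suffices
(`half_le_bayesRisk`). Here `E₀ L²` is the average of `exp (μ² |S ∩ T|)` over pairs of cliques, and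
cliques sharing `z` vertices share `z.choose 2` edges. By symmetry one clique can be fixed. Binomial
moments of the hypergeometric overlap (`sum_overlap_le`) then reduce the bound to a geometric series
of ratio `3/5`, whose terms `overlap_term_le` controls. -/

instance (S : Finset ι) (μ : ℝ) : IsProbabilityMeasure (contaminatedLaw S μ) := by
  unfold contaminatedLaw; infer_instance

instance : IsProbabilityMeasure (nullLaw ι) := by
  unfold nullLaw; infer_instance

lemma sum_meanAt_mul (S : Finset ι) (μ : ℝ) (f : ι → ℝ) :
    ∑ i, meanAt S μ i * f i = μ * ∑ i ∈ S, f i := by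
  classical
  simp [meanAt, ite_mul, Finset.mul_sum]

lemma sum_meanAt_mul_meanAt [DecidableEq ι] (S T : Finset ι) (μ ν : ℝ) :
    ∑ i, meanAt S μ i * meanAt T ν i = μ * ν * ((S ∩ T).card : ℝ) := by
  rw [sum_meanAt_mul]
  simp only [meanAt, Finset.sum_ite_mem, Finset.sum_const, nsmul_eq_mul]
  rw [mul_assoc, mul_comm ν]
  congr!

/-- Exponentials of linear forms are integrable under a product of unit-variance Gaussians. -/
lemma integrable_exp_sum_pi_gaussianReal (a b : ι → ℝ) :
    Integrable (fun x : ι → ℝ => Real.exp (∑ i, b i * x i))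
      (Measure.pi fun i => gaussianReal (a i) 1) := by
  simp only [Real.exp_sum]
  exact Integrable.fintype_prod_dep fun i => integrable_exp_mul_gaussianReal (b i)

/-- The moment generating function of a product of unit-variance Gaussians. -/
lemma integral_exp_sum_pi_gaussianReal (a b : ι → ℝ) :
    ∫ x : ι → ℝ, Real.exp (∑ i, b i * x i) ∂(Measure.pi fun i => gaussianReal (a i) 1) =
      Real.exp (∑ i, (a i * b i + b i ^ 2 / 2)) := by
  simp only [Real.exp_sum]
  rw [integral_fintype_prod_eq_prod (fun i (x : ℝ) => Real.exp (b i * x))]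
  refine Finset.prod_congr rfl fun i _ => ?_
  have := congrFun (mgf_id_gaussianReal (μ := a i) (v := 1)) (b i)
  simpa [mgf] using this

/-- The likelihood ratio of the law contaminated on `S` against the null law, in closed form. -/
noncomputable def shiftRatio (S : Finset ι) (μ : ℝ) (x : ι → ℝ) : ℝ :=
  Real.exp (∑ i, (meanAt S μ i * x i - meanAt S μ i ^ 2 / 2))

lemma gaussianPDFReal_eq_mul_exp (a x : ℝ) :
    gaussianPDFReal a 1 x = gaussianPDFReal 0 1 x * Real.exp (a * x - a ^ 2 / 2) := by
  simp only [gaussianPDFReal, mul_assoc, ← Real.exp_add]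
  congr 2
  simp
  ring

lemma contaminatedDensity_eq (S : Finset ι) (μ : ℝ) (x : ι → ℝ) :
    contaminatedDensity S μ x = nullDensity x * shiftRatio S μ x := by
  simp only [contaminatedDensity, nullDensity, shiftRatio, Real.exp_sum]
  rw [← Finset.prod_mul_distrib]
  exact Finset.prod_congr rfl fun i _ => gaussianPDFReal_eq_mul_exp _ _

lemma nullDensity_pos (x : ι → ℝ) : 0 < nullDensity x :=
  Finset.prod_pos fun _ _ => gaussianPDFReal_pos _ _ _ one_ne_zero

lemma likelihoodRatio_eq (C : Finset (Finset ι)) (μ : ℝ) (x : ι → ℝ) :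
    likelihoodRatio C μ x = 1 / (C.card : ℝ) * ∑ S ∈ C, shiftRatio S μ x := by
  have h := (nullDensity_pos x).ne'
  simp only [likelihoodRatio, contaminatedDensity_eq, ← Finset.mul_sum]
  field_simp

lemma gaussianReal_eq_withDensity (a : ℝ) :
    gaussianReal a 1 =
      (gaussianReal 0 1).withDensity fun x => ENNReal.ofReal (Real.exp (a * x - a ^ 2 / 2)) := by
  rw [gaussianReal_of_var_ne_zero _ one_ne_zero, gaussianReal_of_var_ne_zero _ one_ne_zero,
    ← withDensity_mul _ (measurable_gaussianPDF _ _) (by fun_prop)]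
  congr 1
  ext x
  simp only [gaussianPDF, Pi.mul_apply]
  rw [gaussianPDFReal_eq_mul_exp, ENNReal.ofReal_mul (gaussianPDFReal_nonneg _ _ _)]

lemma integrable_exp_linear_gaussianReal (a c m : ℝ) :
    Integrable (fun x => Real.exp (a * x - c)) (gaussianReal m 1) := by
  simp only [Real.exp_sub]
  exact (integrable_exp_mul_gaussianReal a).div_const _

lemma contaminatedLaw_eq_withDensity (S : Finset ι) (μ : ℝ) :
    contaminatedLaw S μ =
      (nullLaw ι).withDensity fun x => ENNReal.ofReal (shiftRatio S μ x) := by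
  -- A product measure is determined on boxes, where the integral of the density factors over
  -- coordinates.
  refine Measure.pi_eq fun s hs => ?_
  rw [withDensity_apply _ (MeasurableSet.univ_pi hs), nullLaw, Measure.restrict_pi_pi]
  simp only [shiftRatio, Real.exp_sum]
  rw [← ofReal_integral_eq_lintegral_ofReal,
    integral_fintype_prod_eq_prod
      (fun i (x : ℝ) => Real.exp (meanAt S μ i * x - meanAt S μ i ^ 2 / 2)),
    ENNReal.ofReal_prod_of_nonneg]
  · refine Finset.prod_congr rfl fun i _ => ?_
    rw [gaussianReal_eq_withDensity (meanAt S μ i), withDensity_apply _ (hs i),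
      ofReal_integral_eq_lintegral_ofReal]
    · exact (integrable_exp_linear_gaussianReal _ _ _).restrict
    · exact ae_of_all _ fun _ => (Real.exp_pos _).le
  · exact fun i _ => integral_nonneg fun _ => (Real.exp_pos _).le
  · exact Integrable.fintype_prod_dep
      (f := fun i (x : ℝ) => Real.exp (meanAt S μ i * x - meanAt S μ i ^ 2 / 2))
      fun i => (integrable_exp_linear_gaussianReal _ _ _).restrict
  · exact ae_of_all _ fun _ => Finset.prod_nonneg fun _ _ => (Real.exp_pos _).le

lemma shiftRatio_pos (S : Finset ι) (μ : ℝ) (x : ι → ℝ) : 0 < shiftRatio S μ x :=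
  Real.exp_pos _

lemma measurable_shiftRatio (S : Finset ι) (μ : ℝ) : Measurable (shiftRatio S μ) := by
  unfold shiftRatio; fun_prop

lemma shiftRatio_eq_mul (S : Finset ι) (μ : ℝ) (x : ι → ℝ) :
    shiftRatio S μ x =
      Real.exp (∑ i, meanAt S μ i * x i) * Real.exp (-∑ i, meanAt S μ i ^ 2 / 2) := by
  rw [shiftRatio, ← Real.exp_add, Finset.sum_sub_distrib, sub_eq_add_neg]

lemma integrable_shiftRatio (S : Finset ι) (μ : ℝ) :
    Integrable (shiftRatio S μ) (nullLaw ι) := by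
  simp only [funext (shiftRatio_eq_mul S μ)]
  exact (integrable_exp_sum_pi_gaussianReal _ _).mul_const _

lemma shiftRatio_mul_shiftRatio (S T : Finset ι) (μ : ℝ) (x : ι → ℝ) :
    shiftRatio S μ x * shiftRatio T μ x =
      Real.exp (∑ i, (meanAt S μ i + meanAt T μ i) * x i) *
        Real.exp (-∑ i, (meanAt S μ i ^ 2 + meanAt T μ i ^ 2) / 2) := by
  simp only [shiftRatio, ← Real.exp_add, ← Finset.sum_add_distrib, ← Finset.sum_neg_distrib]
  congr 1
  exact Finset.sum_congr rfl fun i _ => by ring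

lemma integrable_shiftRatio_mul (S T : Finset ι) (μ : ℝ) :
    Integrable (fun x => shiftRatio S μ x * shiftRatio T μ x) (nullLaw ι) := by
  simp only [shiftRatio_mul_shiftRatio]
  exact (integrable_exp_sum_pi_gaussianReal _ _).mul_const _

/-- With means `a`, `b` on the two sides, `(a + b)² / 2 - (a² + b²) / 2 = a b`, which survives only
on `S ∩ T`. -/
lemma integral_shiftRatio_mul [DecidableEq ι] (S T : Finset ι) (μ : ℝ) :
    ∫ x, shiftRatio S μ x * shiftRatio T μ x ∂(nullLaw ι) =
      Real.exp (μ ^ 2 * ((S ∩ T).card : ℝ)) := by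
  simp only [shiftRatio_mul_shiftRatio]
  rw [integral_mul_const, nullLaw, integral_exp_sum_pi_gaussianReal, ← Real.exp_add, sq μ,
    ← sum_meanAt_mul_meanAt, ← Finset.sum_neg_distrib, ← Finset.sum_add_distrib]
  congr 1
  exact Finset.sum_congr rfl fun i _ => by ring

lemma contaminatedLaw_real_eq_setIntegral (S : Finset ι) (μ : ℝ) {A : Set (ι → ℝ)}
    (hA : MeasurableSet A) :
    (contaminatedLaw S μ).real A = ∫ x in A, shiftRatio S μ x ∂(nullLaw ι) := by
  rw [contaminatedLaw_eq_withDensity, measureReal_def, withDensity_apply _ hA,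
    ← ofReal_integral_eq_lintegral_ofReal (integrable_shiftRatio S μ).restrict
      (ae_of_all _ fun x => (shiftRatio_pos S μ x).le),
    ENNReal.toReal_ofReal (integral_nonneg fun x => (shiftRatio_pos S μ x).le)]

lemma integrable_likelihoodRatio (C : Finset (Finset ι)) (μ : ℝ) :
    Integrable (likelihoodRatio C μ) (nullLaw ι) := by
  simp only [funext (likelihoodRatio_eq C μ)]
  exact (integrable_finsetSum _ fun S _ => integrable_shiftRatio S μ).const_mul _

lemma measurable_likelihoodRatio (C : Finset (Finset ι)) (μ : ℝ) :
    Measurable (likelihoodRatio C μ) := by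
  simp only [funext (likelihoodRatio_eq C μ)]
  exact (Finset.measurable_sum _ fun S _ => measurable_shiftRatio S μ).const_mul _

lemma measurable_optimalTest (C : Finset (Finset ι)) (μ : ℝ) :
    Measurable (optimalTest C μ) := by
  refine measurable_to_bool ?_
  have : optimalTest C μ ⁻¹' {true} = {x | 1 < likelihoodRatio C μ x} := by
    ext x; simp [optimalTest]
  rw [this]
  exact measurableSet_lt measurable_const (measurable_likelihoodRatio C μ)

/-- The risk of a test in terms of the likelihood ratio on its rejection region. -/
lemma risk_eq_one_sub {C : Finset (Finset ι)} (hC : C.Nonempty) (μ : ℝ) {f : (ι → ℝ) → Bool}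
    (hf : Measurable f) :
    risk C μ f = 1 - ∫ x in {x | f x = true}, (likelihoodRatio C μ x - 1) ∂(nullLaw ι) := by
  have hA : MeasurableSet {x | f x = true} := hf (measurableSet_singleton true)
  have hcompl : {x | f x = false} = {x | f x = true}ᶜ := by ext x; simp
  have hN : (C.card : ℝ) ≠ 0 := by exact_mod_cast hC.card_pos.ne'
  have hterm : ∀ S, (contaminatedLaw S μ).real {x | f x = false} =
      1 - ∫ x in {x | f x = true}, shiftRatio S μ x ∂(nullLaw ι) := fun S => by
    rw [hcompl, probReal_compl_eq_one_sub hA, contaminatedLaw_real_eq_setIntegral S μ hA]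
  have hL : ∫ x in {x | f x = true}, likelihoodRatio C μ x ∂(nullLaw ι) =
      1 / (C.card : ℝ) * ∑ S ∈ C, ∫ x in {x | f x = true}, shiftRatio S μ x ∂(nullLaw ι) := by
    simp only [likelihoodRatio_eq]
    rw [integral_const_mul, integral_finsetSum _ fun S _ => (integrable_shiftRatio S μ).restrict]
  rw [risk, Finset.sum_congr rfl fun S _ => hterm S, Finset.sum_sub_distrib,
    integral_sub (integrable_likelihoodRatio C μ).restrict (integrable_const _), hL]
  simp only [Finset.sum_const, nsmul_eq_mul, mul_one, integral_const, measureReal_restrict_apply,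
    MeasurableSet.univ, Set.univ_inter, smul_eq_mul]
  field_simp
  ring

/-- The likelihood ratio test minimises the risk. -/
lemma bayesRisk_le_risk {C : Finset (Finset ι)} (hC : C.Nonempty) (μ : ℝ) {f : (ι → ℝ) → Bool}
    (hf : Measurable f) : bayesRisk C μ ≤ risk C μ f := by
  have hopt := measurable_optimalTest C μ
  rw [bayesRisk, risk_eq_one_sub hC μ hopt, risk_eq_one_sub hC μ hf]
  refine sub_le_sub_left ?_ 1
  have hint : Integrable (fun x => likelihoodRatio C μ x - 1) (nullLaw ι) :=
    (integrable_likelihoodRatio C μ).sub (integrable_const _)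
  have hA : MeasurableSet {x | f x = true} := hf (measurableSet_singleton true)
  have hB : MeasurableSet {x | optimalTest C μ x = true} := hopt (measurableSet_singleton true)
  rw [← integral_indicator hA, ← integral_indicator hB]
  -- Pointwise: the optimal rejection region collects exactly the positive values of `L - 1`.
  refine integral_mono (hint.indicator hA) (hint.indicator hB) fun x => ?_
  by_cases hx : 1 < likelihoodRatio C μ x
  · simp only [Set.indicator, Set.mem_ofPred_eq, optimalTest, hx, decide_true, if_true]
    split_ifs <;> linarith
  · simp only [Set.indicator, Set.mem_ofPred_eq, optimalTest, hx, decide_false]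
    split_ifs <;> first | contradiction | linarith

/-- Second moment lower bound: if the second moment of the likelihood ratio is at most `2`, then
the Bayes risk is at least `1 / 2`. -/
lemma half_le_bayesRisk [DecidableEq ι] {C : Finset (Finset ι)} (hC : C.Nonempty) (μ : ℝ)
    (h : ∀ S ∈ C, ∑ T ∈ C, Real.exp (μ ^ 2 * ((S ∩ T).card : ℝ)) ≤ 2 * (C.card : ℝ)) :
    1 / 2 ≤ bayesRisk C μ := by
  have hopt := measurable_optimalTest C μ
  have hN : (0 : ℝ) < C.card := by exact_mod_cast hC.card_pos
  have hB : MeasurableSet {x | optimalTest C μ x = true} := hopt (measurableSet_singleton true)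
  have hint := integrable_likelihoodRatio C μ
  have hsq : ∀ x, likelihoodRatio C μ x ^ 2 =
      1 / (C.card : ℝ) ^ 2 * ∑ S ∈ C, ∑ T ∈ C, shiftRatio S μ x * shiftRatio T μ x := fun x => by
    rw [likelihoodRatio_eq, mul_pow, sq (∑ S ∈ C, _), Finset.sum_mul_sum]
    simp
  have hinner : ∀ S, Integrable (fun x => ∑ T ∈ C, shiftRatio S μ x * shiftRatio T μ x)
      (nullLaw ι) := fun S => integrable_finsetSum _ fun T _ => integrable_shiftRatio_mul S T μ
  have hintsq : Integrable (fun x => likelihoodRatio C μ x ^ 2) (nullLaw ι) := by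
    simp only [hsq]
    exact (integrable_finsetSum _ fun S _ => hinner S).const_mul _
  have hmean : ∫ x, likelihoodRatio C μ x ∂(nullLaw ι) = 1 := by
    have hS : ∀ S : Finset ι, ∫ x, shiftRatio S μ x ∂(nullLaw ι) = 1 := fun S => by
      rw [← setIntegral_univ, ← contaminatedLaw_real_eq_setIntegral S μ MeasurableSet.univ]
      simp
    simp only [likelihoodRatio_eq]
    rw [integral_const_mul, integral_finsetSum _ fun S _ => integrable_shiftRatio S μ]
    simp [hS, hN.ne']
  have hsecond : ∫ x, likelihoodRatio C μ x ^ 2 ∂(nullLaw ι) ≤ 2 := by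
    simp only [hsq]
    rw [integral_const_mul, integral_finsetSum _ fun S _ => hinner S]
    have hle : ∑ S ∈ C, ∫ x, ∑ T ∈ C, shiftRatio S μ x * shiftRatio T μ x ∂(nullLaw ι) ≤
        ∑ _S ∈ C, 2 * (C.card : ℝ) := Finset.sum_le_sum fun S hS => by
      rw [integral_finsetSum _ fun T _ => integrable_shiftRatio_mul S T μ]
      simpa only [integral_shiftRatio_mul] using h S hS
    calc _ ≤ 1 / (C.card : ℝ) ^ 2 * ∑ _S ∈ C, 2 * (C.card : ℝ) := by gcongr
      _ = 2 := by
        simp only [Finset.sum_const, nsmul_eq_mul]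
        field_simp
  -- `(L - 2)² ≥ 0` gives `L - 1 ≤ L² / 4`, whose integral is at most `2 / 4`.
  have hkey : ∫ x in {x | optimalTest C μ x = true}, (likelihoodRatio C μ x - 1) ∂(nullLaw ι) ≤
      1 / 2 := by
    rw [← integral_indicator hB]
    have hint1 := hint.sub (integrable_const (1 : ℝ))
    have hmajor : Integrable (fun x => likelihoodRatio C μ x ^ 2 / 4) (nullLaw ι) :=
      hintsq.div_const 4
    calc ∫ x, Set.indicator {x | optimalTest C μ x = true} (fun x => likelihoodRatio C μ x - 1) x
          ∂(nullLaw ι)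
        ≤ ∫ x, likelihoodRatio C μ x ^ 2 / 4 ∂(nullLaw ι) := by
          refine integral_mono (hint1.indicator hB) hmajor fun x => ?_
          simp only [Set.indicator]
          split_ifs
          · nlinarith [sq_nonneg (likelihoodRatio C μ x - 2)]
          · positivity
      _ ≤ 1 / 2 := by
          rw [integral_div]
          linarith
  rw [bayesRisk, risk_eq_one_sub hC μ hopt]
  linarith

/-! ### Chernoff bounds and the scan test. -/

/-- Chernoff bound for the sum over `S` under the null law. -/
lemma nullLaw_real_le_sum_le {S : Finset ι} {t : ℝ} (ht : 0 ≤ t) (hS : 0 < S.card) :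
    (nullLaw ι).real {x | t ≤ ∑ i ∈ S, x i} ≤ Real.exp (-t ^ 2 / (2 * (S.card : ℝ))) := by
  classical
  have hK : (0 : ℝ) < S.card := by exact_mod_cast hS
  -- `t / S.card` is the tilt minimising the Chernoff exponent; the tilted sum is a linear form with
  -- coefficients `meanAt`.
  have hform : ∀ x : ι → ℝ, t / S.card * ∑ i ∈ S, x i =
      ∑ i, meanAt S (t / S.card) i * x i := fun x => (sum_meanAt_mul _ _ _).symm
  have h := measure_ge_le_exp_mul_mgf (μ := nullLaw ι) (X := fun x => ∑ i ∈ S, x i) t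
    (div_nonneg ht hK.le) (by
      simp only [hform]
      exact integrable_exp_sum_pi_gaussianReal _ _)
  refine h.trans_eq ?_
  simp only [mgf, hform]
  rw [nullLaw, integral_exp_sum_pi_gaussianReal, ← Real.exp_add]
  simp only [zero_mul, zero_add, sq (meanAt _ _ _), ← Finset.sum_div]
  rw [sum_meanAt_mul_meanAt, Finset.inter_self]
  congr 1
  field_simp
  ring

/-- Chernoff bound for the sum over `S` under the law contaminated on `S`. -/
lemma contaminatedLaw_real_sum_le_le {S : Finset ι} {μ t : ℝ} (ht : t ≤ μ * S.card)
    (hS : 0 < S.card) :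
    (contaminatedLaw S μ).real {x | ∑ i ∈ S, x i ≤ t} ≤
      Real.exp (-(μ * S.card - t) ^ 2 / (2 * (S.card : ℝ))) := by
  classical
  have hK : (0 : ℝ) < S.card := by exact_mod_cast hS
  -- The optimal tilt for the lower tail, hence nonpositive.
  set l := (t - μ * S.card) / S.card with hl
  have hform : ∀ x : ι → ℝ, l * ∑ i ∈ S, x i = ∑ i, meanAt S l i * x i :=
    fun x => (sum_meanAt_mul _ _ _).symm
  have h := measure_le_le_exp_mul_mgf (μ := contaminatedLaw S μ) (X := fun x => ∑ i ∈ S, x i) t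
    (t := l) (div_nonpos_of_nonpos_of_nonneg (by linarith) hK.le) (by
      simp only [hform]
      exact integrable_exp_sum_pi_gaussianReal _ _)
  refine h.trans_eq ?_
  simp only [mgf, hform]
  rw [contaminatedLaw, integral_exp_sum_pi_gaussianReal, ← Real.exp_add]
  simp only [sq (meanAt _ _ _), Finset.sum_add_distrib, ← Finset.sum_div]
  rw [sum_meanAt_mul_meanAt, sum_meanAt_mul_meanAt, Finset.inter_self, hl]
  congr 1
  field_simp
  ring

/-- Risk bound for the scan test that rejects when some sum over a set of the class is at least
`t`, and hence for the optimal test, when all sets of the class have the same cardinality. -/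
lemma bayesRisk_le_of_scan {C : Finset (Finset ι)} (hC : C.Nonempty) {K : ℕ} (hK : 0 < K)
    (hcard : ∀ S ∈ C, S.card = K) {μ t : ℝ} (ht : 0 ≤ t) (htμ : t ≤ μ * K) :
    bayesRisk C μ ≤ (C.card : ℝ) * Real.exp (-t ^ 2 / (2 * (K : ℝ))) +
      Real.exp (-(μ * K - t) ^ 2 / (2 * (K : ℝ))) := by
  classical
  have hN : (0 : ℝ) < C.card := by exact_mod_cast hC.card_pos
  let f : (ι → ℝ) → Bool := fun x => decide (∃ S ∈ C, t ≤ ∑ i ∈ S, x i)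
  have hset : {x | f x = true} = ⋃ S ∈ C, {x : ι → ℝ | t ≤ ∑ i ∈ S, x i} := by
    ext x; simp [f]
  have hf : Measurable f := by
    refine measurable_to_bool ?_
    change MeasurableSet {x | f x = true}
    rw [hset]
    refine Finset.measurableSet_biUnion _ fun S _ => ?_
    exact measurableSet_le measurable_const (by fun_prop)
  refine (bayesRisk_le_risk hC μ hf).trans (add_le_add ?_ ?_)
  · rw [hset]
    refine (measureReal_biUnion_finset_le _ _).trans ?_
    refine (Finset.sum_le_card_nsmul _ _ _ fun S hS => ?_).trans_eq (nsmul_eq_mul _ _)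
    have := nullLaw_real_le_sum_le (S := S) ht (by rw [hcard S hS]; exact hK)
    rwa [hcard S hS] at this
  · rw [one_div, inv_mul_le_iff₀ hN]
    refine (Finset.sum_le_card_nsmul _ _ _ fun S hS => ?_).trans_eq (nsmul_eq_mul _ _)
    have := contaminatedLaw_real_sum_le_le (S := S) (μ := μ) (t := t)
      (by rwa [hcard S hS]) (by rw [hcard S hS]; exact hK)
    rw [hcard S hS] at this
    refine (measureReal_mono fun x hx => ?_).trans this
    have hx' : ∀ S ∈ C, ∑ i ∈ S, x i < t := by simpa [f] using hx
    exact (hx' S hS).le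

end Probability

/-! ### Edge sets of cliques. -/

section Cliques

lemma card_edgesWithin {m : ℕ} (V : Finset (Fin m)) :
    (edgesWithin V).card = V.card.choose 2 := by
  classical
  rw [← Sym2.card_image_offDiag, ← Finset.card_map (Function.Embedding.subtype _)]
  congr 1
  ext e
  induction e using Sym2.ind with
  | _ a b =>
    simp only [edgesWithin, Finset.mem_map, Finset.mem_filter, Finset.mem_univ, true_and,
      Function.Embedding.coe_subtype, Subtype.exists, Finset.mem_image, Finset.mem_offDiag,
      Prod.exists, Function.uncurry_apply_pair]
    constructor
    · rintro ⟨e, he, h, rfl⟩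
      exact ⟨a, b, ⟨h a (by simp), h b (by simp), by simpa using he⟩, rfl⟩
    · rintro ⟨c, d, ⟨hc, hd, hcd⟩, h⟩
      refine ⟨s(a, b), ?_, ?_, rfl⟩
      · rw [← h]; simpa using hcd
      · rw [← h]; simp [hc, hd]

lemma edgesWithin_inter {m : ℕ} [DecidableEq (Edge m)] (V W : Finset (Fin m)) :
    edgesWithin V ∩ edgesWithin W = edgesWithin (V ∩ W) := by
  ext e
  simp only [edgesWithin, Finset.mem_inter, Finset.mem_filter, Finset.mem_univ, true_and]
  exact ⟨fun h v hv => ⟨h.1 v hv, h.2 v hv⟩,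
    fun h => ⟨fun v hv => (h v hv).1, fun v hv => (h v hv).2⟩⟩

/-- Each vertex of `V` lies on an edge inside `V`; this fails for a single vertex, which spans no
edge. -/
lemma subset_of_edgesWithin_subset {m : ℕ} {V W : Finset (Fin m)} (hV : 2 ≤ V.card)
    (h : edgesWithin V ⊆ edgesWithin W) : V ⊆ W := by
  intro v hv
  obtain ⟨w, hw, hne⟩ := Finset.exists_mem_ne (by omega : 1 < V.card) v
  have he : (⟨s(v, w), by simpa using hne.symm⟩ : Edge m) ∈ edgesWithin V := by
    simp [edgesWithin, hv, hw]
  have := h he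
  simp only [edgesWithin, Finset.mem_filter, Finset.mem_univ, true_and] at this
  exact this v (by simp)

lemma cliqueClass_eq (m k : ℕ) :
    cliqueClass m k = (Finset.univ.powersetCard k).image edgesWithin := by
  unfold cliqueClass
  congr 1
  ext V
  simp [SimpleGraph.isNClique_iff, SimpleGraph.isClique_iff, Set.Pairwise]

lemma edgesWithin_injOn {m k : ℕ} (hk : 2 ≤ k) :
    Set.InjOn (edgesWithin (m := m)) (Finset.univ.powersetCard k : Finset (Finset (Fin m))) := by
  intro V hV W hW h
  have hV' : V.card = k := by simpa using hV
  have hW' : W.card = k := by simpa using hW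
  exact (subset_of_edgesWithin_subset (by omega) h.le).antisymm
    (subset_of_edgesWithin_subset (by omega) h.ge)

lemma card_cliqueClass {m k : ℕ} (hk : 2 ≤ k) : (cliqueClass m k).card = m.choose k := by
  rw [cliqueClass_eq, Finset.card_image_of_injOn (edgesWithin_injOn hk)]
  simp

lemma card_of_mem_cliqueClass {m k : ℕ} {S : Finset (Edge m)} (hS : S ∈ cliqueClass m k) :
    S.card = k.choose 2 := by
  rw [cliqueClass_eq] at hS
  obtain ⟨V, hV, rfl⟩ := Finset.mem_image.1 hS
  rw [card_edgesWithin]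
  simp at hV
  rw [hV]

lemma cliqueClass_nonempty {m k : ℕ} (h : k ≤ m) : (cliqueClass m k).Nonempty := by
  rw [cliqueClass_eq]
  exact (Finset.powersetCard_nonempty.2 (by simpa using h)).image _

end Cliques

/-! ### Overlap of two `k`-subsets. -/

section Counting

/-- Factorial moments of the hypergeometric distribution: for a fixed `k`-subset `V`, the binomial
moment of order `j` of the overlap with a `k`-subset. -/
lemma sum_choose_card_inter {m k j : ℕ} (hj : j ≤ k) {V : Finset (Fin m)} (hV : V.card = k) :
    ∑ W ∈ Finset.univ.powersetCard k, (V ∩ W).card.choose j =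
      k.choose j * (m - j).choose (k - j) := by
  -- Double counting of pairs `A ⊆ V ∩ W` with `A.card = j`.
  have h : ∀ W : Finset (Fin m), (V ∩ W).card.choose j =
      ∑ A ∈ V.powersetCard j, if A ⊆ W then 1 else 0 := fun W => by
    rw [← Finset.card_powersetCard, Finset.sum_boole, Nat.cast_id]
    congr 1
    ext A
    simp only [Finset.mem_powersetCard, Finset.mem_filter, Finset.subset_inter_iff]
    tauto
  rw [Finset.sum_congr rfl fun W _ => h W, Finset.sum_comm]
  have h2 : ∀ A ∈ V.powersetCard j, (∑ W ∈ Finset.univ.powersetCard k, if A ⊆ W then 1 else 0) =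
      (m - j).choose (k - j) := fun A hA => by
    rw [Finset.sum_boole, Nat.cast_id]
    have hA' := (Finset.mem_powersetCard.1 hA).2
    rw [Finset.card_filter_powersetCard_subset A Finset.univ k (Finset.subset_univ _)
      (by omega), hA', Finset.card_univ, Fintype.card_fin]
  rw [Finset.sum_congr rfl h2, Finset.sum_const, Finset.card_powersetCard, hV, smul_eq_mul]

lemma descFactorial_mul_pow_le {m k : ℕ} (hkm : k ≤ m) (j : ℕ) :
    k.descFactorial j * m ^ j ≤ k ^ j * m.descFactorial j := by
  induction j with
  | zero => simp
  | succ j ih =>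
    rw [Nat.descFactorial_succ, Nat.descFactorial_succ, pow_succ, pow_succ]
    have h : (k - j) * m ≤ k * (m - j) := by
      rw [Nat.sub_mul, Nat.mul_sub, mul_comm k j]
      exact Nat.sub_le_sub_left (Nat.mul_le_mul_left j hkm) _
    calc (k - j) * k.descFactorial j * (m ^ j * m)
        = ((k - j) * m) * (k.descFactorial j * m ^ j) := by ring
      _ ≤ (k * (m - j)) * (k ^ j * m.descFactorial j) := Nat.mul_le_mul h ih
      _ = _ := by ring

/-- The ratio of the two binomials is `k.choose j / m.choose j`, a product of factors `(k - i) / (m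
- i) ≤ k / m`. -/
lemma choose_sub_le {m k j : ℕ} (hkm : k ≤ m) (hj : j ≤ k) (hk : 1 ≤ k) :
    ((m - j).choose (k - j) : ℝ) ≤ ((k : ℝ) / m) ^ j * m.choose k := by
  have hm : (0 : ℝ) < m := by exact_mod_cast hk.trans hkm
  have hmj : (0 : ℝ) < m.choose j := by exact_mod_cast Nat.choose_pos (hj.trans hkm)
  have h1 : (m.choose k : ℝ) * k.choose j = m.choose j * (m - j).choose (k - j) := by
    exact_mod_cast Nat.choose_mul hj
  have h2 : (k.choose j : ℝ) * m ^ j ≤ k ^ j * m.choose j := by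
    have h := descFactorial_mul_pow_le hkm j
    rw [Nat.descFactorial_eq_factorial_mul_choose, Nat.descFactorial_eq_factorial_mul_choose] at h
    have h' : j.factorial * (k.choose j * m ^ j) ≤ j.factorial * (k ^ j * m.choose j) := by
      linarith
    exact_mod_cast Nat.le_of_mul_le_mul_left h' j.factorial_pos
  rw [div_pow, div_mul_eq_mul_div, le_div_iff₀ (by positivity)]
  refine le_of_mul_le_mul_left ?_ hmj
  calc (m.choose j : ℝ) * ((m - j).choose (k - j) * m ^ j)
      = m.choose k * (k.choose j * m ^ j) := by rw [← mul_assoc, ← h1]; ring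
    _ ≤ m.choose k * (k ^ j * m.choose j) := by gcongr
    _ = _ := by ring

/-- Combines `n.choose j ≤ n^j / j!` with `j^j / j! ≤ e^j`, one term of the exponential series. -/
lemma choose_le_exp_mul_div_pow (n : ℕ) {j : ℕ} (hj : 1 ≤ j) :
    (n.choose j : ℝ) ≤ (n * Real.exp 1 / j) ^ j := by
  have hj' : (0 : ℝ) < j := by exact_mod_cast hj
  have h1 := Nat.choose_le_pow_div (α := ℝ) j n
  have h2 := Real.pow_div_factorial_le_exp (j : ℝ) hj'.le j
  have hf : (0 : ℝ) < j.factorial := by exact_mod_cast j.factorial_pos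
  refine h1.trans ?_
  rw [div_pow, mul_pow, ← Real.exp_nat_mul, mul_one, div_le_div_iff₀ hf (by positivity), mul_assoc]
  refine mul_le_mul_of_nonneg_left ?_ (by positivity)
  rwa [div_le_iff₀ hf] at h2

/-- A bound on the average of a function of the overlap of two `k`-subsets. -/
lemma sum_overlap_le {m k : ℕ} (hkm : k ≤ m) (hk : 1 ≤ k) {V : Finset (Fin m)} (hV : V.card = k)
    {g : ℕ → ℝ} (hg : ∀ j, 0 ≤ g j) (hg0 : g 0 ≤ 1) (hg1 : g 1 ≤ 1)
    (hb : ∀ j, 2 ≤ j → j ≤ k → (k.choose j : ℝ) * ((k : ℝ) / m) ^ j * g j ≤ (3 / 5) ^ j) :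
    ∑ W ∈ Finset.univ.powersetCard k, g (V ∩ W).card ≤ 2 * m.choose k := by
  -- For `z ≥ 2` the single term `j = z` already gives `g z`; the leading `1` covers `z = 0, 1`.
  have hpoint : ∀ z ≤ k, g z ≤ 1 + ∑ j ∈ Finset.Icc 2 k, (z.choose j : ℝ) * g j := fun z hz => by
    have hnn : ∀ j ∈ Finset.Icc 2 k, 0 ≤ (z.choose j : ℝ) * g j :=
      fun j _ => mul_nonneg (by positivity) (hg j)
    rcases Nat.lt_or_ge z 2 with h | h
    · have := Finset.sum_nonneg hnn
      interval_cases z <;> linarith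
    · have := Finset.single_le_sum hnn (Finset.mem_Icc.2 ⟨h, hz⟩)
      rw [Nat.choose_self, Nat.cast_one, one_mul] at this
      linarith
  -- The full series from `j = 2` sums to `9/10`, below the available `1`.
  have hgeom : ∀ n : ℕ, ∑ j ∈ Finset.Icc 2 (n + 1), (3 / 5 : ℝ) ^ j =
      9 / 10 - 9 / 10 * (3 / 5 : ℝ) ^ n := by
    intro n
    induction n with
    | zero => simp
    | succ n ih =>
      rw [Finset.sum_Icc_succ_top (by omega), ih]
      ring
  calc ∑ W ∈ Finset.univ.powersetCard k, g (V ∩ W).card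
      ≤ ∑ W ∈ Finset.univ.powersetCard k,
          (1 + ∑ j ∈ Finset.Icc 2 k, ((V ∩ W).card.choose j : ℝ) * g j) :=
        Finset.sum_le_sum fun W _ => hpoint _ (hV ▸ Finset.card_le_card Finset.inter_subset_left)
    _ = m.choose k + ∑ j ∈ Finset.Icc 2 k,
          ((k.choose j : ℝ) * (m - j).choose (k - j)) * g j := by
        rw [Finset.sum_add_distrib, Finset.sum_comm]
        congr 1
        · simp
        · refine Finset.sum_congr rfl fun j hj => ?_
          rw [← Finset.sum_mul]
          congr 1
          exact_mod_cast sum_choose_card_inter (Finset.mem_Icc.1 hj).2 hV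
    _ ≤ m.choose k + ∑ j ∈ Finset.Icc 2 k, (3 / 5 : ℝ) ^ j * m.choose k := by
        refine add_le_add_right (Finset.sum_le_sum fun j hj => ?_) _
        obtain ⟨h2, hjk⟩ := Finset.mem_Icc.1 hj
        calc ((k.choose j : ℝ) * (m - j).choose (k - j)) * g j
            ≤ ((k.choose j : ℝ) * (((k : ℝ) / m) ^ j * m.choose k)) * g j := by
              gcongr
              · exact hg j
              · exact choose_sub_le hkm hjk hk
          _ = ((k.choose j : ℝ) * ((k : ℝ) / m) ^ j * g j) * m.choose k := by ring
          _ ≤ _ := by gcongr; exact hb j h2 hjk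
    _ ≤ 2 * m.choose k := by
        rw [← Finset.sum_mul]
        have h1 : ∑ j ∈ Finset.Icc 2 k, (3 / 5 : ℝ) ^ j ≤ 1 := by
          obtain ⟨n, rfl⟩ := Nat.exists_eq_add_of_le' hk
          rw [hgeom]
          linarith [show (0 : ℝ) ≤ (3 / 5) ^ n by positivity]
        have h2 : (0 : ℝ) ≤ m.choose k := by positivity
        nlinarith

end Counting

/-! ### Numerical bounds on the overlap terms. -/

section Estimates

/-- The exponential weight of an overlap in `j` vertices, under the upper bound on the signal. -/
lemma exp_overlap_le {k j : ℕ} (hk : 1 ≤ k) (hj : 1 ≤ j) (hjk : j ≤ k) {r μ : ℝ} (hr : 1 ≤ r)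
    (hμ : μ ^ 2 ≤ 1 / k * Real.log r) :
    Real.exp (μ ^ 2 * (j.choose 2 : ℕ)) ≤ (1 + (j - 1) * r / (4 * k)) ^ j := by
  have hk' : (0 : ℝ) < k := by exact_mod_cast hk
  have hj' : (1 : ℝ) ≤ j := by exact_mod_cast hj
  have hjk' : (j : ℝ) ≤ k := by exact_mod_cast hjk
  have hs : 0 < Real.sqrt r := Real.sqrt_pos.2 (by linarith)
  have hs4 : Real.sqrt r - 1 ≤ r / 4 := by
    nlinarith [sq_nonneg (Real.sqrt r - 2), Real.sq_sqrt (by linarith : 0 ≤ r)]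
  have hp0 : 0 ≤ ((j : ℝ) - 1) / k := div_nonneg (by linarith) hk'.le
  have hp1 : ((j : ℝ) - 1) / k ≤ 1 := (div_le_one hk').2 (by linarith)
  -- Bernoulli's inequality for the exponent `(j - 1) / k ∈ [0, 1]`, applied to `√r` so that `√r - 1
  -- ≤ r / 4` can follow.
  have hbern := rpow_one_add_le_one_add_mul_self (s := Real.sqrt r - 1) (by linarith) hp0 hp1
  have hbase : Real.exp (((j : ℝ) - 1) / (2 * k) * Real.log r) ≤ 1 + (j - 1) * r / (4 * k) := by
    calc Real.exp (((j : ℝ) - 1) / (2 * k) * Real.log r)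
        = (1 + (Real.sqrt r - 1)) ^ (((j : ℝ) - 1) / k) := by
          rw [add_sub_cancel, Real.rpow_def_of_pos hs, Real.log_sqrt (by linarith)]
          congr 1
          field_simp
      _ ≤ 1 + (j - 1) / k * (Real.sqrt r - 1) := hbern
      _ ≤ 1 + (j - 1) / k * (r / 4) := by gcongr
      _ = _ := by field_simp
  calc Real.exp (μ ^ 2 * (j.choose 2 : ℕ))
      ≤ Real.exp (1 / k * Real.log r * (j.choose 2 : ℕ)) := by gcongr
    _ = Real.exp (((j : ℝ) - 1) / (2 * k) * Real.log r) ^ j := by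
        rw [← Real.exp_nat_mul, Nat.cast_choose_two]
        congr 1
        field_simp
    _ ≤ _ := by gcongr

lemma overlap_term_le {m k j : ℕ} (hk : 1 ≤ k) (hj : 2 ≤ j) (hjk : j ≤ k) (hm : 0 < m)
    (hkm : (k : ℝ) ^ 2 * Real.exp 1 ≤ m * Real.log 2) {μ : ℝ}
    (hμ : μ ^ 2 ≤ 1 / k * Real.log (m / (2 * k))) :
    (k.choose j : ℝ) * ((k : ℝ) / m) ^ j * Real.exp (μ ^ 2 * (j.choose 2 : ℕ)) ≤ (3 / 5) ^ j := by
  have hk' : (1 : ℝ) ≤ k := by exact_mod_cast hk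
  have hj' : (2 : ℝ) ≤ j := by exact_mod_cast hj
  have hm' : (0 : ℝ) < m := by exact_mod_cast hm
  have hlog : Real.log 2 < 0.7 := by linarith [Real.log_two_lt_d9]
  have he : Real.exp 1 < 2.8 := by linarith [Real.exp_one_lt_d9]
  have he' : 2.7 < Real.exp 1 := by linarith [Real.exp_one_gt_d9]
  have hr : 1 ≤ (m : ℝ) / (2 * k) := by
    rw [le_div_iff₀ (by positivity)]
    nlinarith
  have h1 := choose_le_exp_mul_div_pow k (by omega : 1 ≤ j)
  have h2 := exp_overlap_le hk (by omega) hjk hr hμ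
  calc (k.choose j : ℝ) * ((k : ℝ) / m) ^ j * Real.exp (μ ^ 2 * (j.choose 2 : ℕ))
      ≤ (k * Real.exp 1 / j) ^ j * ((k : ℝ) / m) ^ j *
          (1 + (j - 1) * (m / (2 * k)) / (4 * k)) ^ j := by gcongr
    _ = ((k ^ 2 * Real.exp 1 / m + Real.exp 1 * (j - 1) / 8) / j) ^ j := by
        rw [← mul_pow, ← mul_pow]
        congr 1
        field_simp
        ring
    -- The base is at most `(0.7 + 0.35 (j - 1)) / j = 0.35 (1 + 1 / j) ≤ 0.525` for `j ≥ 2`, using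
    -- `k² e / m ≤ log 2 < 0.7` and `e / 8 < 0.35`.
    _ ≤ (3 / 5) ^ j := by
        have h3 : (k : ℝ) ^ 2 * Real.exp 1 / m ≤ 0.7 := by
          rw [div_le_iff₀ hm']; nlinarith
        have h0 : 0 ≤ (j : ℝ) - 1 := by linarith
        refine pow_le_pow_left₀ (by positivity) ?_ j
        rw [div_le_iff₀ (by linarith)]
        nlinarith

end Estimates

/-! ### The two bounds for cliques. -/

lemma half_le_bayesRisk_cliqueClass {m k : ℕ} (hk : 1 ≤ k) (hkm : k ≤ m)
    (hsq : (k : ℝ) ^ 2 * Real.exp 1 ≤ m * Real.log 2) {μ : ℝ}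
    (hμ : μ ^ 2 ≤ 1 / k * Real.log (m / (2 * k))) :
    1 / 2 ≤ bayesRisk (cliqueClass m k) μ := by
  classical
  refine half_le_bayesRisk (cliqueClass_nonempty hkm) μ fun S hS => ?_
  -- For `k = 1` every clique has empty edge set, so all weights are `1` and vertex sets need not be
  -- counted.
  rcases hk.eq_or_lt with rfl | hk2
  · have hS0 : S = ∅ := by
      rw [← Finset.card_eq_zero, card_of_mem_cliqueClass hS]; rfl
    have hN : (0 : ℝ) ≤ (cliqueClass m 1).card := by positivity
    simp only [hS0, Finset.empty_inter, Finset.card_empty, Nat.cast_zero, mul_zero, Real.exp_zero,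
      Finset.sum_const, nsmul_eq_mul, mul_one]
    linarith
  · rw [card_cliqueClass hk2]
    rw [cliqueClass_eq] at hS ⊢
    obtain ⟨V, hV, rfl⟩ := Finset.mem_image.1 hS
    rw [Finset.sum_image (edgesWithin_injOn hk2)]
    simp only [edgesWithin_inter, card_edgesWithin]
    exact sum_overlap_le hkm hk (g := fun j => Real.exp (μ ^ 2 * (j.choose 2 : ℕ)))
      (Finset.mem_powersetCard.1 hV).2 (fun _ => (Real.exp_pos _).le) (by simp) (by simp)
      fun j h2 hj => overlap_term_le hk h2 hj (by omega) hsq hμ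

lemma bayesRisk_cliqueClass_le {m k : ℕ} (hk : 2 ≤ k) (hkm : k ≤ m) {δ μ : ℝ} (hδ : 0 < δ)
    (hδ1 : δ < 1)
    (hμ : 2 * Real.sqrt (1 / ((k : ℝ) - 1) * Real.log ((m : ℝ) * Real.exp 1 / (k : ℝ)))
      + 4 * Real.sqrt (Real.log (2 / δ) / ((k : ℝ) * ((k : ℝ) - 1))) ≤ μ) :
    bayesRisk (cliqueClass m k) μ ≤ δ := by
  have hk' : (2 : ℝ) ≤ k := by exact_mod_cast hk
  have hkm' : (k : ℝ) ≤ m := by exact_mod_cast hkm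
  have hK : (0 : ℝ) < k * (k - 1) := mul_pos (by linarith) (by linarith)
  set l := Real.log ((m : ℝ) * Real.exp 1 / (k : ℝ)) with hl
  set D := Real.log (2 / δ) with hD
  have hratio : 1 ≤ (m : ℝ) * Real.exp 1 / k := by
    rw [le_div_iff₀ (by linarith)]
    nlinarith [Real.add_one_le_exp (1 : ℝ)]
  have hl0 : 0 ≤ l := Real.log_nonneg hratio
  have hD0 : 0 ≤ D := Real.log_nonneg (by rw [le_div_iff₀ hδ]; linarith)
  have hexpD : Real.exp (-D) = δ / 2 := by
    rw [hD, ← Real.log_inv, Real.exp_log (by positivity), inv_div]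
  have hNl : (m.choose k : ℝ) ≤ Real.exp (k * l) := by
    rw [Real.exp_nat_mul, hl, Real.exp_log (by linarith)]
    exact choose_le_exp_mul_div_pow m (by omega)
  set q := Real.sqrt (k * (k - 1)) with hq
  set a := Real.sqrt (k * l) with ha
  set b := Real.sqrt D with hb
  have hq0 : 0 < q := Real.sqrt_pos.2 hK
  have hq2 : q ^ 2 = k * (k - 1) := Real.sq_sqrt hK.le
  have ha0 : 0 ≤ a := Real.sqrt_nonneg _
  have hb0 : 0 ≤ b := Real.sqrt_nonneg _
  have ha2 : a ^ 2 = k * l := Real.sq_sqrt (by positivity)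
  have hb2 : b ^ 2 = D := Real.sq_sqrt hD0
  have hμ' : 2 * (a / q) + 4 * (b / q) ≤ μ := by
    convert hμ using 3
    · rw [ha, hq, ← Real.sqrt_div' _ hK.le]
      congr 1
      have : (k : ℝ) - 1 ≠ 0 := by linarith
      field_simp
    · rw [hb, hq, ← Real.sqrt_div' _ hK.le]
  have hchoose : ((k.choose 2 : ℕ) : ℝ) = q ^ 2 / 2 := by
    rw [Nat.cast_choose_two, hq2]
  have hμK : a * q + 2 * (b * q) ≤ μ * (k.choose 2 : ℕ) := by
    rw [hchoose]
    calc a * q + 2 * (b * q) = (2 * (a / q) + 4 * (b / q)) * (q ^ 2 / 2) := by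
          field_simp
          ring
      _ ≤ μ * (q ^ 2 / 2) := by gcongr
  have hbq : 0 ≤ b * q := by positivity
  -- As `q² = 2 * k.choose 2`, this threshold makes the type II bound exactly `exp (-b²) = δ / 2`.
  -- The condition on `μ` leaves `t ≥ (a + b) q`, so the null tail is at most `exp (-a² - b²)`, and
  -- `exp (-a²)` absorbs the number of cliques.
  set t := μ * (k.choose 2 : ℕ) - b * q with ht
  have htge : (a + b) * q ≤ t := by rw [ht]; linarith
  have hbound := bayesRisk_le_of_scan (cliqueClass_nonempty hkm) (Nat.choose_pos hk)
    (fun S hS => card_of_mem_cliqueClass hS) (μ := μ) (t := t)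
    (le_trans (by positivity) htge) (by linarith)
  refine hbound.trans ?_
  have h1 : Real.exp (-(μ * (k.choose 2 : ℕ) - t) ^ 2 / (2 * (k.choose 2 : ℕ))) = δ / 2 := by
    rw [← hexpD, ht, sub_sub_cancel, hchoose, ← hb2]
    congr 1
    field_simp
  have h2 : Real.exp (-t ^ 2 / (2 * (k.choose 2 : ℕ))) ≤ Real.exp (-(k * l)) * (δ / 2) := by
    rw [← hexpD, ← Real.exp_add, hchoose, Real.exp_le_exp, div_le_iff₀ (by positivity)]
    have h3 : ((a + b) * q) ^ 2 ≤ t ^ 2 := pow_le_pow_left₀ (by positivity) htge 2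
    have h4 : a ^ 2 + b ^ 2 ≤ (a + b) ^ 2 := by nlinarith [mul_nonneg ha0 hb0]
    have h5 : (a ^ 2 + b ^ 2) * q ^ 2 ≤ t ^ 2 := by
      rw [mul_pow] at h3
      exact (mul_le_mul_of_nonneg_right h4 (by positivity)).trans h3
    rw [← ha2, ← hb2]
    linarith
  rw [card_cliqueClass hk, h1]
  have h6 : (m.choose k : ℝ) * Real.exp (-t ^ 2 / (2 * (k.choose 2 : ℕ))) ≤ δ / 2 := by
    calc _ ≤ Real.exp (k * l) * (Real.exp (-(k * l)) * (δ / 2)) := by gcongr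
      _ = δ / 2 := by rw [← mul_assoc, ← Real.exp_add]; simp
  linarith

end CliqueTesting

theorem mainTheorem7 (m k : ℕ) (hk : 1 ≤ k)
    (hkm : (k : ℝ) ≤ Real.sqrt ((m : ℝ) * Real.log 2 / Real.exp 1)) :
    (2 ≤ k → ∀ δ : ℝ, 0 < δ → δ < 1 → ∀ μ : ℝ, 0 < μ →
      2 * Real.sqrt (1 / ((k : ℝ) - 1) * Real.log ((m : ℝ) * Real.exp 1 / (k : ℝ)))
          + 4 * Real.sqrt (Real.log (2 / δ) / ((k : ℝ) * ((k : ℝ) - 1))) ≤ μ →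
        CliqueTesting.bayesRisk (CliqueTesting.cliqueClass m k) μ ≤ δ) ∧
    (∀ μ : ℝ, 0 < μ →
      μ ≤ Real.sqrt (1 / (k : ℝ) * Real.log ((m : ℝ) / (2 * (k : ℝ)))) →
        1 / 2 ≤ CliqueTesting.bayesRisk (CliqueTesting.cliqueClass m k) μ) := by
  have hk' : (1 : ℝ) ≤ k := by exact_mod_cast hk
  have hsq : (k : ℝ) ^ 2 * Real.exp 1 ≤ m * Real.log 2 := by
    rw [← le_div_iff₀ (Real.exp_pos 1)]
    have h0 : 0 ≤ (m : ℝ) * Real.log 2 / Real.exp 1 := by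
      have := Real.log_nonneg (by norm_num : (1 : ℝ) ≤ 2)
      positivity
    exact (Real.le_sqrt (by linarith) h0).1 hkm
  have hle : k ≤ m := by
    have hlog : Real.log 2 ≤ 1 := by linarith [Real.log_two_lt_d9]
    have he : 1 ≤ Real.exp 1 := Real.one_le_exp zero_le_one
    have hm : (0 : ℝ) ≤ m := Nat.cast_nonneg m
    have : (k : ℝ) ≤ m := by nlinarith
    exact_mod_cast this
  refine ⟨fun hk2 δ hδ hδ1 μ _ hμ => CliqueTesting.bayesRisk_cliqueClass_le hk2 hle hδ hδ1 hμ,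
    fun μ hμ0 hμ => CliqueTesting.half_le_bayesRisk_cliqueClass hk hle hsq ?_⟩
  -- `Real.sqrt` vanishes at nonpositive arguments, so a positive `μ` below it forces a positive
  -- radicand.
  have hpos : 0 < 1 / (k : ℝ) * Real.log ((m : ℝ) / (2 * (k : ℝ))) :=
    Real.sqrt_pos.1 (hμ0.trans_le hμ)
  exact (Real.le_sqrt hμ0.le hpos.le).1 hμ
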